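/- Let $n\ge 3$ and $k$ be integers with $1<k<n/2$, let $p>1$ be real, and write $C_{n-1}^{k-1}=\binom{n-1}{k-1}$. Consider the radial $k$-Hessian equation $$-\tfrac1k C_{n-1}^{k-1}\,(r^{n-k}|u'|^{k-1}u')'=r^{n-1}u^{p},\qquad u(r)>0,\quad r>0. \tag{1}$$ A solution of (1) is a positive $u\in C^1(0,\infty)$ for which $r^{n-k}|u'|^{k-1}u'$ is differentiable and (1) holds on $(0,\infty)$. A solution $u$ is *regular* if in addition $u$ is defined at $0$, $u'(0)=0$, $u(0)>0$ and $x\mapsto u(|x|)$ belongs to $C^2(\mathbb R^n)$. For $R>0$, a solution $u$ of (1) is *stable on* $(R,\infty)$ if $$\int_0^\infty\Big[\tfrac1k C_{n-1}^{k-1} r^{n-k}|u'|^{k-1}u'\varphi'-r^{n-1}u^p\varphi\Big]dr=0$$ (with both terms integrable) for every $\varphi$ such that $x\mapsto\varphi(|x|)$ belongs to $C_c^\infty(\mathbb R^n)$, and $$Q_u(\varphi)=C_{n-1}^{k-1}\int_0^\infty r^{n-k}|u'|^{k-1}(\varphi')^2dr-p\int_0^\infty r^{n-1}u^{p-1}\varphi^2dr\ge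 0\quad\text{for every }\varphi\in C_c^\infty(R,\infty).$$ Put $p_{se}=\frac{nk}{n-2k}$, $p_{so}=\frac{(n+2)k}{n-2k}$, $p^*=k\frac{n+2k}{n-2k}$, and let $p_{jl}=\infty$ if $n\le 2k+8$ and $$p_{jl}=\frac{k[n^2-2(k+3)n+4k]+4k\sqrt{2(k+1)n-4k}}{(n-2k)(n-2k-8)}\quad\text{if } n>2k+8.$$ (i) If $p=p_{so}$ or $p\ge\max\{p^*,p_{jl}\}$, then for every regular solution $u$ of (1) there is $R>0$ such that $u$ is stable on $(R,\infty)$. (ii) Let $p_{se}<p<p_{so}$ and $$u_s(r)=Ar^{-\frac{2k}{p-k}},\qquad A=\Big(\tfrac1kC_{n-1}^{k-1}\Big)^{\frac1{p-k}}\Big(\tfrac{2k}{p-k}\Big)^{\frac k{p-k}}\Big(n-\tfrac{2pk}{p-k}\Big)^{\frac1{p-k}}.$$ Then for every solution $U_s$ of (1) with $U_s(r)/u_s(r)\to1$ as $r\to0$ and $U_s(r)\,r^{\frac{n-2k}{k}}\to\lambda$ as $r\to\infty$ for some $\lambda>0$, there is $R>0$ such that $U_s$ is stable on $(R,\infty)$.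 -/

import Mathlib

open Set Filter Topology MeasureTheory
open scoped ContDiff

noncomputable section

namespace KHessian

/-- The Serrin exponent `nk/(n-2k)`. -/
def pSerrin (n k : ℕ) : ℝ := (n : ℝ) * k / ((n : ℝ) - 2 * k)

/-- The Sobolev exponent `(n+2)k/(n-2k)`. -/
def pSobolev (n k : ℕ) : ℝ := ((n : ℝ) + 2) * k / ((n : ℝ) - 2 * k)

/-- The exponent `p^* = k(n+2k)/(n-2k)`. -/
def pStar (n k : ℕ) : ℝ := (k : ℝ) * (((n : ℝ) + 2 * k) / ((n : ℝ) - 2 * k))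

/-- The Joseph-Lundgren exponent, which is infinite when `n ≤ 2k + 8`. -/
def pJL (n k : ℕ) : EReal :=
  if n ≤ 2 * k + 8 then ⊤
  else
    ((((k : ℝ) * ((n : ℝ) ^ 2 - 2 * ((k : ℝ) + 3) * n + 4 * k)
        + 4 * k * Real.sqrt (2 * ((k : ℝ) + 1) * n - 4 * k))
      / (((n : ℝ) - 2 * k) * ((n : ℝ) - 2 * k - 8)) : ℝ) : EReal)

/-- The binomial coefficient `C_{n-1}^{k-1}`, as a real number. -/
def binom (n k : ℕ) : ℝ := ((n - 1).choose (k - 1) : ℝ)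

/-- The flux `r^{n-k} |u'(r)|^{k-1} u'(r)`. -/
def flux (n k : ℕ) (u : ℝ → ℝ) (r : ℝ) : ℝ :=
  r ^ (n - k) * |deriv u r| ^ (k - 1) * deriv u r

/-- `u` is a positive `C^1` solution on `(0,∞)` of
`-(1/k) C_{n-1}^{k-1} (r^{n-k}|u'|^{k-1}u')' = r^{n-1} u^p`. Only the values of `u` on `(0,∞)`
matter. -/
structure IsSolution (n k : ℕ) (p : ℝ) (u : ℝ → ℝ) : Prop where
  contDiffOn : ContDiffOn ℝ 1 u (Ioi 0)
  pos : ∀ r : ℝ, 0 < r → 0 < u r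
  differentiableAt_flux : ∀ r : ℝ, 0 < r → DifferentiableAt ℝ (flux n k u) r
  equation : ∀ r : ℝ, 0 < r →
    -(1 / (k : ℝ) * binom n k * deriv (flux n k u) r) = r ^ (n - 1) * u r ^ p

/-- Regular solutions: `u` solves the equation on `(0,∞)`, `u'(0) = 0` (as a one-sided derivative),
`u(0) > 0`, and `x ↦ u(|x|)` is of class `C^2` on the Euclidean space `ℝⁿ`. -/
structure IsRegularSolution (n k : ℕ) (p : ℝ) (u : ℝ → ℝ) : Prop extends
    IsSolution n k p u where
  deriv_zero : HasDerivWithinAt u 0 (Ici 0) 0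
  zero_pos : 0 < u 0
  contDiff_norm : ContDiff ℝ 2 (fun x : EuclideanSpace ℝ (Fin n) => u ‖x‖)

/-- The constant `A` of the explicit singular solution. -/
def singularConst (n k : ℕ) (p : ℝ) : ℝ :=
  (1 / (k : ℝ) * binom n k) ^ (1 / (p - k)) *
    (2 * (k : ℝ) / (p - k)) ^ ((k : ℝ) / (p - k)) *
    ((n : ℝ) - 2 * p * k / (p - k)) ^ (1 / (p - k))

/-- The explicit singular solution `u_s(r) = A r^{-2k/(p-k)}`. -/
def uSing (n k : ℕ) (p : ℝ) (r : ℝ) : ℝ :=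
  singularConst n k p * r ^ (-(2 * (k : ℝ) / (p - k)))

/-- Fast decaying singular solutions: positive solutions `U` on `(0,∞)` with `U/u_s → 1` at `0` and
`U(r) r^{(n-2k)/k} → lam` at infinity, for some `lam > 0`. -/
structure IsFastDecaySingularSolution (n k : ℕ) (p : ℝ) (U : ℝ → ℝ) : Prop extends
    IsSolution n k p U where
  tendsto_zero : Tendsto (fun r => U r / uSing n k p r) (𝓝[>] 0) (𝓝 1)
  tendsto_atTop : ∃ lam : ℝ, 0 < lam ∧
    Tendsto (fun r : ℝ => U r * r ^ (((n : ℝ) - 2 * k) / k)) atTop (𝓝 lam)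

/-- The class `W_*` of radial profiles of functions in `C_c^∞(ℝⁿ)`. -/
def RadialTest (n : ℕ) (φ : ℝ → ℝ) : Prop :=
  ContDiff ℝ ∞ (fun x : EuclideanSpace ℝ (Fin n) => φ ‖x‖) ∧
    HasCompactSupport (fun x : EuclideanSpace ℝ (Fin n) => φ ‖x‖)

/-- The weak form of the equation, tested with `φ`. Both terms are required to be integrable. -/
def WeakEquation (n k : ℕ) (p : ℝ) (u φ : ℝ → ℝ) : Prop :=
  IntegrableOn (fun r => 1 / (k : ℝ) * binom n k * flux n k u r * deriv φ r) (Ioi 0) ∧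
  IntegrableOn (fun r => r ^ (n - 1) * u r ^ p * φ r) (Ioi 0) ∧
  ∫ r in Ioi (0 : ℝ), (1 / (k : ℝ) * binom n k * flux n k u r * deriv φ r
      - r ^ (n - 1) * u r ^ p * φ r) = 0

/-- The quadratic form `Q_u(φ)`. -/
def Q (n k : ℕ) (p : ℝ) (u φ : ℝ → ℝ) : ℝ :=
  binom n k * (∫ r in Ioi (0 : ℝ), r ^ (n - k) * |deriv u r| ^ (k - 1) * deriv φ r ^ 2)
    - p * ∫ r in Ioi (0 : ℝ), r ^ (n - 1) * u r ^ (p - 1) * φ r ^ 2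

/-- `u` is a stable solution on `(R,∞)`. For `φ ∈ C_c^∞(R,∞)` with `R > 0` both integrands of
`Q_u(φ)` are continuous with compact support in `(R,∞)`, so the integrals always converge. -/
structure IsStableOn (n k : ℕ) (p R : ℝ) (u : ℝ → ℝ) : Prop where
  isSolution : IsSolution n k p u
  weak : ∀ φ : ℝ → ℝ, RadialTest n φ → WeakEquation n k p u φ
  nonneg : ∀ φ : ℝ → ℝ, ContDiff ℝ ∞ φ → HasCompactSupport φ → tsupport φ ⊆ Ioi R →
    0 ≤ Q n k p u φ

end KHessian

end

noncomputable section

namespace KHessian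

/-! ### Monotonicity on the half-line -/

/-! Write w = C_{n-1}^{k-1} r^{n-k}|u'|^{k-1} and V = p r^{n-1} u^{p-1}. Stability on (R,∞) follows
once some θ satisfies θ' + θ²/w + V ≤ 0 there, by completing the square
(`integral_sub_nonneg_of_riccati`). The weak equation is an integration by parts, whose boundary
term disappears because the flux tends to 0 at the origin (`HasVanishingFlux.weakEquation`).

Two mechanisms produce θ. If u = O(r^{-(n-2k)/k}) and p exceeds the Serrin exponent, then V is
negligible at infinity against the Hardy weight of w (`exists_isStableOn_of_fast_decay`). At the
Sobolev exponent the decay comes from the Pohozaev identity, which integrates the equation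
explicitly. For U_s the decay is assumed, and the singularity r^{-2k/(p-k)} is too weak for a
nonzero flux at 0.

In the Joseph-Lundgren range, α u + r u' with α = 2k/(p-k) solves the linearized equation, and θ is
w times its logarithmic derivative. Its positivity, `slope_lt`, is a phase plane statement: in the
variable log r, the slope -ru'/u and the logarithmic derivative of the flux form an autonomous
system. The explicit singular solution is an equilibrium, which the range makes a node, so a line
through it serves as a barrier. -/

lemma monotoneOn_of_hasDerivAt_nonneg {D : Set ℝ} (hD : Convex ℝ D) {f f' : ℝ → ℝ}
    (hf : ∀ r ∈ D, HasDerivAt f (f' r) r) (hf' : ∀ r ∈ D, 0 ≤ f' r) : MonotoneOn f D :=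
  monotoneOn_of_deriv_nonneg hD (fun r hr => (hf r hr).continuousAt.continuousWithinAt)
    (fun r hr => (hf r (interior_subset hr)).differentiableAt.differentiableWithinAt)
    (fun r hr => by
      rw [(hf r (interior_subset hr)).deriv]
      exact hf' r (interior_subset hr))

lemma antitoneOn_of_hasDerivAt_nonpos {D : Set ℝ} (hD : Convex ℝ D) {f f' : ℝ → ℝ}
    (hf : ∀ r ∈ D, HasDerivAt f (f' r) r) (hf' : ∀ r ∈ D, f' r ≤ 0) : AntitoneOn f D := by
  have h := monotoneOn_of_hasDerivAt_nonneg hD (f := fun r => -f r) (f' := fun r => -f' r)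
    (fun r hr => (hf r hr).neg) (fun r hr => neg_nonneg.2 (hf' r hr))
  intro a ha b hb hab
  exact neg_le_neg_iff.1 (h ha hb hab)

lemma le_of_monotoneOn_of_tendsto {f : ℝ → ℝ} {l : ℝ} (hf : MonotoneOn f (Ioi 0))
    (h0 : Tendsto f (𝓝[>] 0) (𝓝 l)) {r : ℝ} (hr : 0 < r) : l ≤ f r := by
  refine le_of_tendsto h0 ?_
  filter_upwards [Ioo_mem_nhdsGT hr] with s hs
  exact hf hs.1 hr hs.2.le

lemma eq_of_hasDerivAt_zero {f : ℝ → ℝ} (hf : ∀ r ∈ Ioi (0 : ℝ), HasDerivAt f 0 r) {r s : ℝ}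
    (hr : 0 < r) (hs : 0 < s) : f r = f s :=
  isOpen_Ioi.is_const_of_deriv_eq_zero isPreconnected_Ioi
    (fun t ht => (hf t ht).differentiableAt.differentiableWithinAt)
    (fun t ht => (hf t ht).deriv) hr hs

/-! ### A Riccati criterion for nonnegativity of the quadratic form -/

/-- If `θ' + θ²/w + V ≤ 0` on `(R,∞)`, then `∫ w φ'² ≥ ∫ V φ²` for `φ ∈ C_c^∞(R,∞)`. -/
lemma integral_sub_nonneg_of_riccati {R : ℝ} (hR : 0 < R) {w V θ θ' : ℝ → ℝ}
    (hw : ContinuousOn w (Ioi R)) (hV : ContinuousOn V (Ioi R))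
    (hwpos : ∀ r ∈ Ioi R, 0 < w r) (hθ : ∀ r ∈ Ioi R, HasDerivAt θ (θ' r) r)
    (hric : ∀ r ∈ Ioi R, θ' r + θ r ^ 2 / w r + V r ≤ 0) {φ : ℝ → ℝ} (hφ : ContDiff ℝ ∞ φ)
    (hc : HasCompactSupport φ) (hs : tsupport φ ⊆ Ioi R) :
    0 ≤ (∫ r in Ioi (0 : ℝ), w r * deriv φ r ^ 2) - ∫ r in Ioi (0 : ℝ), V r * φ r ^ 2 := by
  obtain ⟨a, b, hRa, hab, hsub⟩ : ∃ a b, R < a ∧ a ≤ b ∧ tsupport φ ⊆ Ioo a b := by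
    rcases (tsupport φ).eq_empty_or_nonempty with he | hne
    · exact ⟨R + 1, R + 1, by linarith, le_rfl, by simp [he]⟩
    · have hK : IsCompact (tsupport φ) := hc
      obtain ⟨x, hx, hxmin⟩ := hK.exists_isLeast hne
      obtain ⟨y, hy, hymax⟩ := hK.exists_isGreatest hne
      have hRx : R < x := hs hx
      have hxy : x ≤ y := hxmin hy
      refine ⟨(R + x) / 2, y + 1, by linarith, by linarith, fun z hz => ⟨?_, ?_⟩⟩
      · have := hxmin hz; linarith
      · have := hymax hz; linarith
  have hφ0 : ∀ r, r ∉ Ioo a b → φ r = 0 := fun r hr => image_eq_zero_of_notMem_tsupport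
    (fun h => hr (hsub h))
  have hdφ0 : ∀ r, r ∉ Ioo a b → deriv φ r = 0 := fun r hr =>
    image_eq_zero_of_notMem_tsupport (fun h => hr (hsub (tsupport_deriv_subset h)))
  have hsubI : Icc a b ⊆ Ioi R := fun r hr => lt_of_lt_of_le hRa hr.1
  have hIoc0 : Ioc a b ⊆ Ioi (0 : ℝ) := fun r hr => lt_trans (hR.trans hRa) hr.1
  have hdφ : Continuous (deriv φ) := hφ.continuous_deriv (by simp)
  have e1 : ∫ r in Ioi (0 : ℝ), w r * deriv φ r ^ 2 = ∫ r in a..b, w r * deriv φ r ^ 2 := by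
    rw [intervalIntegral.integral_of_le hab]
    refine setIntegral_eq_of_subset_of_forall_sdiff_eq_zero measurableSet_Ioi hIoc0 ?_
    intro r hr
    rw [hdφ0 r (fun h => hr.2 ⟨h.1, h.2.le⟩)]; simp
  have e2 : ∫ r in Ioi (0 : ℝ), V r * φ r ^ 2 = ∫ r in a..b, V r * φ r ^ 2 := by
    rw [intervalIntegral.integral_of_le hab]
    refine setIntegral_eq_of_subset_of_forall_sdiff_eq_zero measurableSet_Ioi hIoc0 ?_
    intro r hr
    rw [hφ0 r (fun h => hr.2 ⟨h.1, h.2.le⟩)]; simp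
  have c1 : ContinuousOn (fun r => w r * deriv φ r ^ 2) (Icc a b) :=
    (hw.mono hsubI).mul (hdφ.pow 2).continuousOn
  have c2 : ContinuousOn (fun r => V r * φ r ^ 2) (Icc a b) :=
    (hV.mono hsubI).mul (hφ.continuous.pow 2).continuousOn
  have hdiff : ∀ r ∈ Icc a b, HasDerivAt (fun r => θ r * φ r ^ 2)
      (θ' r * φ r ^ 2 + θ r * (2 * φ r * deriv φ r)) r := fun r hr => by
    have h1 : HasDerivAt φ (deriv φ r) r := (hφ.differentiable (by simp) r).hasDerivAt
    have h2 := (hθ r (hsubI hr)).mul (h1.pow 2)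
    exact h2.congr_deriv (by simp)
  rw [e1, e2, ← intervalIntegral.integral_sub (c1.intervalIntegrable_of_Icc hab)
    (c2.intervalIntegrable_of_Icc hab)]
  -- θφ² vanishes at both endpoints. The integrand minus (θφ²)' equals w(φ' - θφ/w)² - (θ' + θ²/w +
  -- V)φ² ≥ 0.
  have key := intervalIntegral.sub_le_integral_of_hasDeriv_right_of_le (a := a) (b := b)
    (g := fun r => θ r * φ r ^ 2) (g' := fun r => θ' r * φ r ^ 2 + θ r * (2 * φ r * deriv φ r))
    (φ := fun r => w r * deriv φ r ^ 2 - V r * φ r ^ 2) hab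
    (fun r hr => (hdiff r hr).continuousAt.continuousWithinAt)
    (fun r hr => (hdiff r (Ioo_subset_Icc_self hr)).hasDerivWithinAt)
    (c1.sub c2).integrableOn_Icc ?_
  · simpa [hφ0 a (by simp), hφ0 b (by simp)] using key
  · intro r hr
    have hrR := hsubI (Ioo_subset_Icc_self hr)
    have hwr := hwpos r hrR
    have h1 := mul_nonneg (neg_nonneg.2 (hric r hrR)) (sq_nonneg (φ r))
    have h2 : 0 ≤ w r * (deriv φ r - θ r * φ r / w r) ^ 2 := by positivity
    have h3 : w r * (deriv φ r - θ r * φ r / w r) ^ 2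
        = w r * deriv φ r ^ 2 - 2 * θ r * φ r * deriv φ r + θ r ^ 2 / w r * φ r ^ 2 := by
      field_simp
      ring
    nlinarith [h1, h2, h3]

/-! ### Solutions whose flux vanishes at the origin -/

/-- Positive solutions whose flux tends to zero at the origin. -/
structure HasVanishingFlux (n k : ℕ) (p : ℝ) (u : ℝ → ℝ) : Prop where
  one_lt : 1 < k
  two_mul_lt : 2 * k < n
  one_lt_exponent : 1 < p
  isSolution : IsSolution n k p u
  tendsto_flux : Tendsto (flux n k u) (𝓝[>] 0) (𝓝 0)

/-- The coefficient `C_{n-1}^{k-1}/k`. -/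
def coeff (n k : ℕ) : ℝ := 1 / (k : ℝ) * binom n k

lemma binom_pos {n k : ℕ} (hkn : k ≤ n) : 0 < binom n k := by
  unfold binom
  exact_mod_cast Nat.choose_pos (by omega)

lemma coeff_pos {n k : ℕ} (hk : 0 < k) (hkn : k ≤ n) : 0 < coeff n k := by
  have := binom_pos hkn
  unfold coeff
  positivity

lemma mul_coeff {n k : ℕ} (hk : 0 < k) : (k : ℝ) * coeff n k = binom n k := by
  unfold coeff
  field_simp

lemma IsSolution.hasDerivAt_flux {n k : ℕ} {p : ℝ} {u : ℝ → ℝ} (h : IsSolution n k p u)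
    (hk : 0 < k) (hkn : k ≤ n) {r : ℝ} (hr : 0 < r) :
    HasDerivAt (flux n k u) (-(r ^ (n - 1) * u r ^ p / coeff n k)) r := by
  have h1 := (h.differentiableAt_flux r hr).hasDerivAt
  have h2 := h.equation r hr
  have hc := coeff_pos hk hkn
  refine h1.congr_deriv ?_
  rw [← h2]
  change _ = -(-(coeff n k * _) / coeff n k)
  field_simp

lemma IsSolution.hasDerivAt {n k : ℕ} {p : ℝ} {u : ℝ → ℝ} (h : IsSolution n k p u)
    {r : ℝ} (hr : 0 < r) : HasDerivAt u (deriv u r) r :=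
  ((h.contDiffOn.differentiableOn (by simp)).differentiableAt (Ioi_mem_nhds hr)).hasDerivAt

lemma flux_nonneg_iff {n k : ℕ} {u : ℝ → ℝ} {r : ℝ} (hr : 0 < r) :
    0 ≤ flux n k u r ↔ 0 ≤ deriv u r := by
  unfold flux
  constructor
  · intro h
    by_contra! hd
    have : 0 < |deriv u r| := abs_pos.2 hd.ne
    have h2 : r ^ (n - k) * |deriv u r| ^ (k - 1) * deriv u r < 0 :=
      mul_neg_of_pos_of_neg (by positivity) hd
    linarith
  · intro h
    positivity

/-- The radial speed `-u'`. -/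
def speed (u : ℝ → ℝ) (r : ℝ) : ℝ := -deriv u r

/-- The outward flux, `r^{n-k} (-u')^k` for decreasing `u`. -/
def outflux (n k : ℕ) (u : ℝ → ℝ) (r : ℝ) : ℝ := -flux n k u r

lemma IsSolution.hasDerivAt_outflux {n k : ℕ} {p : ℝ} {u : ℝ → ℝ} (h : IsSolution n k p u)
    (hk : 0 < k) (hkn : k ≤ n) {r : ℝ} (hr : 0 < r) :
    HasDerivAt (outflux n k u) (r ^ (n - 1) * u r ^ p / coeff n k) r :=
  (h.hasDerivAt_flux hk hkn hr).neg.congr_deriv (neg_neg _)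

lemma IsSolution.monotoneOn_outflux {n k : ℕ} {p : ℝ} {u : ℝ → ℝ} (h : IsSolution n k p u)
    (hk : 0 < k) (hkn : k ≤ n) : MonotoneOn (outflux n k u) (Ioi 0) :=
  monotoneOn_of_hasDerivAt_nonneg (convex_Ioi 0) (fun _ hr => h.hasDerivAt_outflux hk hkn hr)
    fun r hr => by
      have := coeff_pos hk hkn
      have hr : 0 < r := hr
      have := h.pos r hr
      positivity

namespace HasVanishingFlux

variable {n k : ℕ} {p : ℝ} {u : ℝ → ℝ}

lemma k_pos (h : HasVanishingFlux n k p u) : 0 < k := zero_lt_one.trans h.one_lt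

lemma k_le (h : HasVanishingFlux n k p u) : k ≤ n := by
  have := h.two_mul_lt
  omega

lemma coeff_pos (h : HasVanishingFlux n k p u) : 0 < coeff n k :=
  KHessian.coeff_pos h.k_pos h.k_le

lemma pos (h : HasVanishingFlux n k p u) {r : ℝ} (hr : 0 < r) : 0 < u r := h.isSolution.pos r hr

lemma hasDerivAt_outflux (h : HasVanishingFlux n k p u) {r : ℝ} (hr : 0 < r) :
    HasDerivAt (outflux n k u) (r ^ (n - 1) * u r ^ p / coeff n k) r :=
  h.isSolution.hasDerivAt_outflux h.k_pos h.k_le hr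

lemma tendsto_outflux (h : HasVanishingFlux n k p u) :
    Tendsto (outflux n k u) (𝓝[>] 0) (𝓝 0) := by
  simpa using show Tendsto (outflux n k u) (𝓝[>] 0) (𝓝 (-0)) from h.tendsto_flux.neg

lemma monotoneOn_outflux (h : HasVanishingFlux n k p u) : MonotoneOn (outflux n k u) (Ioi 0) :=
  h.isSolution.monotoneOn_outflux h.k_pos h.k_le

lemma outflux_pos (h : HasVanishingFlux n k p u) {r : ℝ} (hr : 0 < r) : 0 < outflux n k u r := by
  have hmono : StrictMonoOn (outflux n k u) (Ioi 0) := by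
    refine strictMonoOn_of_deriv_pos (convex_Ioi 0)
      (fun s hs => (h.hasDerivAt_outflux hs).continuousAt.continuousWithinAt) fun s hs => ?_
    rw [interior_Ioi] at hs
    have hs : 0 < s := hs
    rw [(h.hasDerivAt_outflux hs).deriv]
    have := h.coeff_pos
    have := h.pos hs
    positivity
  have h1 : outflux n k u (r / 2) < outflux n k u r :=
    hmono (half_pos hr) hr (half_lt_self hr)
  exact (le_of_monotoneOn_of_tendsto hmono.monotoneOn h.tendsto_outflux (half_pos hr)).trans_lt h1

lemma speed_pos (h : HasVanishingFlux n k p u) {r : ℝ} (hr : 0 < r) : 0 < speed u r := by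
  have h1 := h.outflux_pos hr
  unfold outflux at h1
  have h2 := (flux_nonneg_iff (n := n) (k := k) (u := u) hr).not.1 (by linarith)
  unfold speed
  linarith [not_le.1 h2]

lemma hasDerivAt (h : HasVanishingFlux n k p u) {r : ℝ} (hr : 0 < r) :
    HasDerivAt u (-speed u r) r :=
  (h.isSolution.hasDerivAt hr).congr_deriv (by simp [speed])

lemma abs_deriv (h : HasVanishingFlux n k p u) {r : ℝ} (hr : 0 < r) :
    |deriv u r| = speed u r := by
  have := h.speed_pos hr
  unfold speed at *
  rw [abs_of_neg (by linarith)]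

lemma outflux_eq (h : HasVanishingFlux n k p u) {r : ℝ} (hr : 0 < r) :
    outflux n k u r = r ^ (n - k) * speed u r ^ k := by
  obtain ⟨j, rfl⟩ : ∃ j, k = j + 1 := ⟨k - 1, by have := h.k_pos; omega⟩
  unfold outflux flux
  rw [h.abs_deriv hr, show deriv u r = -speed u r by simp [speed]]
  simp only [Nat.add_sub_cancel]
  ring

lemma hasDerivAt_rpow (h : HasVanishingFlux n k p u) (q : ℝ) {r : ℝ} (hr : 0 < r) :
    HasDerivAt (fun s => u s ^ q) (-(q * u r ^ (q - 1) * speed u r)) r :=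
  ((h.hasDerivAt hr).rpow_const (Or.inl (h.pos hr).ne')).congr_deriv (by ring)

/-- A solution is only C¹, so the second derivative is recovered from the flux: the speed is the
k-th root of `outflux` divided by r^{n-k}, a positive differentiable function. -/
lemma hasDerivAt_speed (h : HasVanishingFlux n k p u) {r : ℝ} (hr : 0 < r) :
    HasDerivAt (speed u) (speed u r / (k * r) *
      (r ^ n * u r ^ p / (coeff n k * outflux n k u r) - (n - k))) r := by
  have hk : (0 : ℝ) < k := by exact_mod_cast h.k_pos
  have hF := h.outflux_pos hr
  have hg := h.speed_pos hr
  have hc := h.coeff_pos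
  have e : speed u =ᶠ[𝓝 r] fun s => (outflux n k u s * (s ^ (n - k))⁻¹) ^ (1 / (k : ℝ)) := by
    filter_upwards [Ioi_mem_nhds hr] with s hs
    have hs : 0 < s := hs
    rw [h.outflux_eq hs, mul_comm, inv_mul_cancel_left₀ (by positivity),
      one_div, Real.pow_rpow_inv_natCast (h.speed_pos hs).le h.k_pos.ne']
  have hB : HasDerivAt (fun s => outflux n k u s * (s ^ (n - k))⁻¹) _ r :=
    (h.hasDerivAt_outflux hr).mul ((hasDerivAt_pow (n - k) r).inv (by positivity))
  have hBpos : 0 < outflux n k u r * (r ^ (n - k))⁻¹ := by positivity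
  refine ((hB.rpow_const (p := 1 / (k : ℝ)) (Or.inl hBpos.ne')).congr_of_eventuallyEq e).congr_deriv ?_
  rw [Real.rpow_sub_one hBpos.ne', ← e.eq_of_nhds]
  obtain ⟨j, hj⟩ : ∃ j, n = k + 1 + j := ⟨n - k - 1, by have := h.two_mul_lt; have := h.k_pos; omega⟩
  have e1 : n - 1 = k + j := by omega
  have e2 : n - k = j + 1 := by omega
  have e3 : (n : ℝ) = k + 1 + j := by exact_mod_cast hj
  generalize outflux n k u r = F at hF ⊢
  generalize coeff n k = c at hc ⊢
  rw [e1, e2, e3, hj]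
  simp only [Nat.add_sub_cancel]
  push_cast
  field_simp
  ring

/-! ### The weak equation -/

/-- The factor r^{n-k} makes the value at 0 independent of `deriv u 0`. It agrees with the limit, so
the flux is continuous up to the origin even for singular solutions. -/
lemma flux_zero (h : HasVanishingFlux n k p u) : flux n k u 0 = 0 := by
  have : n - k ≠ 0 := by have := h.two_mul_lt; have := h.k_pos; omega
  simp [flux, this]

lemma continuousOn_flux (h : HasVanishingFlux n k p u) : ContinuousOn (flux n k u) (Ici 0) := by
  intro r hr
  rcases eq_or_lt_of_le (show 0 ≤ r from hr) with rfl | hr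
  · rw [← continuousWithinAt_Ioi_iff_Ici, ContinuousWithinAt, h.flux_zero]
    exact h.tendsto_flux
  · exact (h.isSolution.differentiableAt_flux r hr).continuousAt.continuousWithinAt

/-- u may blow up at 0, so no pointwise bound is available. The source is instead the nonnegative
derivative of a function continuous on [0,b]. -/
lemma integrableOn_source (h : HasVanishingFlux n k p u) (b : ℝ) :
    IntegrableOn (fun r => r ^ (n - 1) * u r ^ p) (Ioc 0 b) := by
  have hc := h.coeff_pos
  have := intervalIntegral.integrableOn_deriv_of_nonneg (a := 0) (b := b)
    (g := fun r => coeff n k * outflux n k u r) (g' := fun r => r ^ (n - 1) * u r ^ p)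
    (continuousOn_const.mul (h.continuousOn_flux.neg.mono Icc_subset_Ici_self))
    (fun r hr => ((h.hasDerivAt_outflux hr.1).const_mul (coeff n k)).congr_deriv (by field_simp))
    (fun r hr => by
      have := h.pos hr.1
      have := hr.1
      positivity)
  exact this

end HasVanishingFlux

/-- A radial test profile agrees on the half-line with a compactly supported smooth function. -/
lemma RadialTest.exists_extension {n : ℕ} (hn : 0 < n) {φ : ℝ → ℝ} (hφ : RadialTest n φ) :
    ∃ ψ : ℝ → ℝ, ContDiff ℝ ∞ ψ ∧ (∀ r, 0 ≤ r → φ r = ψ r) ∧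
      ∃ b, 0 < b ∧ ∀ r, b < r → ψ r = 0 := by
  let e : EuclideanSpace ℝ (Fin n) := EuclideanSpace.single ⟨0, hn⟩ 1
  have he : ‖e‖ = 1 := by simp [e]
  have hnorm : ∀ r : ℝ, ‖r • e‖ = |r| := fun r => by rw [norm_smul, he, mul_one, Real.norm_eq_abs]
  refine ⟨fun r => φ ‖r • e‖, hφ.1.comp (contDiff_id.smul contDiff_const), fun r hr => ?_, ?_⟩
  · simp only [hnorm, abs_of_nonneg hr]
  · obtain ⟨b, hb⟩ := hφ.2.isBounded.exists_norm_le
    refine ⟨max b 1, by positivity, fun r hr => ?_⟩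
    have hr' : b < r := (le_max_left _ _).trans_lt hr
    by_contra hne
    have := hb (r • e) (subset_tsupport _ hne)
    rw [hnorm] at this
    linarith [le_abs_self r]

lemma HasVanishingFlux.weakEquation {n k : ℕ} {p : ℝ} {u : ℝ → ℝ} (h : HasVanishingFlux n k p u)
    {φ : ℝ → ℝ} (hφ : RadialTest n φ) : WeakEquation n k p u φ := by
  obtain ⟨ψ, hψ, heq, b, hb, hzero⟩ := hφ.exists_extension (by have := h.two_mul_lt; omega)
  have hdψ : Continuous (deriv ψ) := hψ.continuous_deriv (by simp)
  have hdzero : ∀ r, b < r → deriv ψ r = 0 := fun r hr => by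
    have : ψ =ᶠ[𝓝 r] fun _ => 0 := by
      filter_upwards [Ioi_mem_nhds hr] with s hs using hzero s hs
    rw [this.deriv_eq]
    simp
  have hderiv : ∀ r ∈ Ioi (0 : ℝ), deriv φ r = deriv ψ r := fun r hr => by
    refine Filter.EventuallyEq.deriv_eq ?_
    filter_upwards [Ioi_mem_nhds hr] with s hs using heq s (le_of_lt hs)
  have hsub : Ioc 0 b ⊆ Ioi (0 : ℝ) := fun r hr => hr.1
  have hout : ∀ r ∈ Ioi (0 : ℝ) \ Ioc 0 b, b < r := fun r hr => by
    by_contra! hle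
    exact hr.2 ⟨hr.1, hle⟩
  have i1 : IntegrableOn (fun r => coeff n k * flux n k u r * deriv ψ r) (Ioi 0) := by
    refine IntegrableOn.of_forall_sdiff_eq_zero (s := Ioc 0 b) ?_ measurableSet_Ioi ?_
    · refine IntegrableOn.mono_set (t := Icc 0 b) ?_ Ioc_subset_Icc_self
      exact ((continuousOn_const.mul (h.continuousOn_flux.mono Icc_subset_Ici_self)).mul
        hdψ.continuousOn).integrableOn_Icc
    · intro r hr
      simp [hdzero r (hout r hr)]
  have i2 : IntegrableOn (fun r => r ^ (n - 1) * u r ^ p * ψ r) (Ioi 0) := by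
    refine IntegrableOn.of_forall_sdiff_eq_zero (s := Ioc 0 b) ?_ measurableSet_Ioi ?_
    · refine IntegrableOn.mono_set (t := Icc 0 b) ?_ Ioc_subset_Icc_self
      exact IntegrableOn.mul_continuousOn
        ((integrableOn_Icc_iff_integrableOn_Ioc).2 (h.integrableOn_source b))
        hψ.continuous.continuousOn isCompact_Icc
    · intro r hr
      simp [hzero r (hout r hr)]
  have hc := h.coeff_pos
  have hcont : ContinuousWithinAt (flux n k u) (Ici 0) 0 :=
    h.continuousOn_flux 0 (show (0 : ℝ) ∈ Ici 0 by simp)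
  have i3 : ∫ r in Ioi (0 : ℝ), (coeff n k * flux n k u r * deriv ψ r
      - r ^ (n - 1) * u r ^ p * ψ r) = 0 := by
    have := integral_Ioi_of_hasDerivAt_of_tendsto (a := 0) (m := 0)
      (f := fun r => coeff n k * flux n k u r * ψ r)
      (f' := fun r => coeff n k * flux n k u r * deriv ψ r - r ^ (n - 1) * u r ^ p * ψ r)
      ((continuousWithinAt_const.mul hcont).mul hψ.continuous.continuousWithinAt) ?_
      (i1.sub i2) ?_
    · rw [this, h.flux_zero]
      simp
    · intro r hr
      have h1 : HasDerivAt ψ (deriv ψ r) r := (hψ.differentiable (by simp) r).hasDerivAt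
      refine (((h.isSolution.hasDerivAt_flux h.k_pos h.k_le hr).const_mul (coeff n k)).mul
        h1).congr_deriv ?_
      field_simp
      ring
    · refine tendsto_const_nhds.congr' ?_
      filter_upwards [Ioi_mem_atTop b] with r hr
      simp [hzero r hr]
  refine ⟨i1.congr_fun (fun r hr => ?_) measurableSet_Ioi,
    i2.congr_fun (fun r hr => ?_) measurableSet_Ioi, ?_⟩
  · simp only [coeff, hderiv r hr]
  · simp only [heq r (le_of_lt hr)]
  · refine (setIntegral_congr_fun measurableSet_Ioi fun r hr => ?_).trans i3
    simp only [coeff, hderiv r hr, heq r (le_of_lt hr)]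

/-! ### Stability criteria: Riccati inequality and fast decay -/

namespace HasVanishingFlux

variable {n k : ℕ} {p : ℝ} {u : ℝ → ℝ}

lemma continuousOn_speed (h : HasVanishingFlux n k p u) : ContinuousOn (speed u) (Ioi 0) :=
  fun _ hr => (h.hasDerivAt_speed hr).continuousAt.continuousWithinAt

lemma binom_pos (h : HasVanishingFlux n k p u) : 0 < binom n k := KHessian.binom_pos h.k_le

/-- Stability outside a ball from a solution of the Riccati inequality. -/
lemma isStableOn_of_riccati (h : HasVanishingFlux n k p u) {R : ℝ} (hR : 0 < R) {θ θ' : ℝ → ℝ}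
    (hθ : ∀ r ∈ Ioi R, HasDerivAt θ (θ' r) r)
    (hric : ∀ r ∈ Ioi R, θ' r + θ r ^ 2 / (binom n k * (r ^ (n - k) * speed u r ^ (k - 1)))
      + p * (r ^ (n - 1) * u r ^ (p - 1)) ≤ 0) : IsStableOn n k p R u := by
  refine ⟨h.isSolution, fun φ hφ => h.weakEquation hφ, fun φ hφ hc hs => ?_⟩
  have hsub : Ioi R ⊆ Ioi 0 := Ioi_subset_Ioi hR.le
  have hu : ContinuousOn u (Ioi 0) := h.isSolution.contDiffOn.continuousOn
  have hb := h.binom_pos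
  have key := integral_sub_nonneg_of_riccati hR
    (w := fun r => binom n k * (r ^ (n - k) * speed u r ^ (k - 1)))
    (V := fun r => p * (r ^ (n - 1) * u r ^ (p - 1)))
    (continuousOn_const.mul ((continuous_pow _).continuousOn.mul
      ((h.continuousOn_speed.mono hsub).pow _)))
    (continuousOn_const.mul ((continuous_pow _).continuousOn.mul
      ((hu.mono hsub).rpow_const fun r hr => Or.inl (h.pos (hsub hr)).ne')))
    (fun r hr => by
      have hr' : 0 < r := hsub hr
      have := h.speed_pos hr'
      positivity) hθ hric hφ hc hs
  unfold Q
  rw [← integral_const_mul, ← integral_const_mul]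
  refine key.trans_eq ?_
  congr 1
  · refine setIntegral_congr_fun measurableSet_Ioi fun r hr => ?_
    simp only [h.abs_deriv hr]
    ring
  · refine setIntegral_congr_fun measurableSet_Ioi fun r hr => ?_
    ring

/-- The weight of the quadratic form in terms of the flux. -/
lemma weight_eq (h : HasVanishingFlux n k p u) {r : ℝ} (hr : 0 < r) :
    r ^ (n - k) * speed u r ^ (k - 1)
      = r ^ (((n : ℝ) - k) / k) * outflux n k u r ^ (((k : ℝ) - 1) / k) := by
  have hk : (0 : ℝ) < k := by exact_mod_cast h.k_pos
  have hg := h.speed_pos hr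
  rw [h.outflux_eq hr, Real.mul_rpow (by positivity) (by positivity), ← Real.rpow_natCast r,
    ← Real.rpow_natCast (speed u r) k, ← Real.rpow_natCast (speed u r) (k - 1),
    ← Real.rpow_mul hr.le, ← Real.rpow_mul hg.le, ← mul_assoc, ← Real.rpow_add hr,
    Nat.cast_sub h.k_le, Nat.cast_sub h.k_pos]
  congr 2
  · field_simp
    ring
  · field_simp
    simp

/-- Fast decay at infinity implies stability outside a ball, by Hardy's inequality. -/
lemma exists_isStableOn_of_fast_decay (h : HasVanishingFlux n k p u) (hp : pSerrin n k < p)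
    {C R₀ : ℝ} (hdecay : ∀ r, R₀ < r → u r ≤ C * r ^ (-(((n : ℝ) - 2 * k) / k))) :
    ∃ R : ℝ, 0 < R ∧ IsStableOn n k p R u := by
  have hk : (0 : ℝ) < k := by exact_mod_cast h.k_pos
  have hkn : (0 : ℝ) < n - 2 * k := by
    have : (2 * k : ℝ) < n := by exact_mod_cast h.two_mul_lt
    linarith
  have hp1 := h.one_lt_exponent
  set a : ℝ := ((n : ℝ) - k) / k with ha
  have ha1 : a - 1 = ((n : ℝ) - 2 * k) / k := by rw [ha]; field_simp; ring
  have ha1pos : 0 < a - 1 := by rw [ha1]; positivity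
  have hδ : 0 < (a - 1) * p - n := by
    unfold pSerrin at hp
    rw [div_lt_iff₀ hkn] at hp
    have : (a - 1) * p - n = (p * (n - 2 * k) - n * k) / k := by rw [ha1]; field_simp
    rw [this]
    exact div_pos (by linarith) hk
  set δ := (a - 1) * p - n with hδdef
  have hf := h.outflux_pos one_pos
  have hb := h.binom_pos
  set m : ℝ := binom n k * outflux n k u 1 ^ (((k : ℝ) - 1) / k) with hm
  have hmpos : 0 < m := by positivity
  set D : ℝ := p * (max C 1) ^ (p - 1) with hD
  have hCpos : 0 < max C 1 := by positivity
  have hDpos : 0 < D := by positivity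
  have hsmall : ∀ᶠ r : ℝ in atTop, r ^ (-δ) < m * (a - 1) ^ 2 / 4 / D :=
    (tendsto_rpow_neg_atTop hδ).eventually_lt_const (by positivity)
  obtain ⟨R₁, hR₁⟩ := eventually_atTop.1 hsmall
  have hRpos : 0 < max 1 (max R₀ R₁) := by positivity
  refine ⟨max 1 (max R₀ R₁), hRpos, ?_⟩
  -- The optimal Hardy choice for the weight m r^a, which bounds w from below because the outward
  -- flux increases. Here θ' = -2H and θ²/w ≤ H with H = m(a-1)²/4 · r^{a-2}, leaving room H for V,
  -- which is O(r^{-δ} r^{a-2}).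
  refine h.isStableOn_of_riccati hRpos (θ := fun r => -(m * (a - 1) / 2) * r ^ (a - 1))
    (θ' := fun r => -(m * (a - 1) / 2) * ((a - 1) * r ^ (a - 2))) (fun r hr => ?_) fun r hr => ?_
  · have hr0 : 0 < r := hRpos.trans hr
    refine ((Real.hasDerivAt_rpow_const (Or.inl hr0.ne')).const_mul _).congr_deriv ?_
    ring_nf
  · have hr1 : 1 < r := (le_max_left _ _).trans_lt hr
    have hr0 : 0 < r := one_pos.trans hr1
    have hrR₀ : R₀ < r := ((le_max_left _ _).trans (le_max_right _ _)).trans_lt hr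
    have hrR₁ : R₁ < r := ((le_max_right _ _).trans (le_max_right _ _)).trans_lt hr
    have hu := h.pos hr0
    have hw : m * r ^ a ≤ binom n k * (r ^ (n - k) * speed u r ^ (k - 1)) := by
      rw [h.weight_eq hr0, hm, mul_assoc, mul_comm (r ^ _)]
      have h1 : outflux n k u 1 ≤ outflux n k u r :=
        h.monotoneOn_outflux (mem_Ioi.2 one_pos) hr0 hr1.le
      have h2 : (0 : ℝ) ≤ ((k : ℝ) - 1) / k := by
        have : (1 : ℝ) ≤ k := by exact_mod_cast h.k_pos
        exact div_nonneg (by linarith) hk.le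
      gcongr
    have hθ : (-(m * (a - 1) / 2) * r ^ (a - 1)) ^ 2
          / (binom n k * (r ^ (n - k) * speed u r ^ (k - 1)))
        ≤ m * (a - 1) ^ 2 / 4 * r ^ (a - 2) := by
      have hra : 0 < r ^ a := by positivity
      have e1 : r ^ (a - 1) = r ^ a / r := Real.rpow_sub_one hr0.ne' a
      have e2 : r ^ (a - 2) = r ^ a / r ^ 2 := by
        rw [Real.rpow_sub hr0]
        norm_cast
      calc _ ≤ (-(m * (a - 1) / 2) * r ^ (a - 1)) ^ 2 / (m * r ^ a) := by gcongr
        _ = _ := by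
          rw [e1, e2]
          field_simp
          ring
    have hV : p * (r ^ (n - 1) * u r ^ (p - 1)) ≤ m * (a - 1) ^ 2 / 4 * r ^ (a - 2) := by
      have h1 : u r ≤ max C 1 * r ^ (-(a - 1)) := by
        rw [ha1]
        refine (hdecay r hrR₀).trans ?_
        gcongr
        exact le_max_left _ _
      have h2 : u r ^ (p - 1) ≤ max C 1 ^ (p - 1) * r ^ (-(a - 1) * (p - 1)) := by
        rw [Real.rpow_mul hr0.le, ← Real.mul_rpow hCpos.le (by positivity)]
        exact Real.rpow_le_rpow hu.le h1 (by linarith)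
      have h3 : r ^ (n - 1) * r ^ (-(a - 1) * (p - 1)) = r ^ (-δ) * r ^ (a - 2) := by
        rw [← Real.rpow_natCast r, ← Real.rpow_add hr0, ← Real.rpow_add hr0,
          Nat.cast_sub (h.k_pos.trans_le h.k_le), hδdef]
        congr 1
        push_cast
        ring
      have h4 : r ^ (-δ) * D ≤ m * (a - 1) ^ 2 / 4 := by
        rw [← le_div_iff₀ hDpos]
        exact (hR₁ r hrR₁.le).le
      calc p * (r ^ (n - 1) * u r ^ (p - 1))
          ≤ p * (r ^ (n - 1) * (max C 1 ^ (p - 1) * r ^ (-(a - 1) * (p - 1)))) := by gcongr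
        _ = D * (r ^ (n - 1) * r ^ (-(a - 1) * (p - 1))) := by rw [hD]; ring
        _ = r ^ (-δ) * D * r ^ (a - 2) := by rw [h3]; ring
        _ ≤ _ := by gcongr
    have e3 : -(m * (a - 1) / 2) * ((a - 1) * r ^ (a - 2))
        = -(2 * (m * (a - 1) ^ 2 / 4 * r ^ (a - 2))) := by ring
    simp only [e3]
    linarith

end HasVanishingFlux

/-! ### Regular solutions -/

/-- Solutions with vanishing flux that have a positive limit and a bounded speed at the origin. -/
structure IsRegularAtOrigin (n k : ℕ) (p : ℝ) (u : ℝ → ℝ) : Prop extends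
    HasVanishingFlux n k p u where
  exists_tendsto : ∃ l : ℝ, 0 < l ∧ Tendsto u (𝓝[>] 0) (𝓝 l)
  exists_tendsto_speed : ∃ d : ℝ, Tendsto (speed u) (𝓝[>] 0) (𝓝 d)

/-- Along a line through the origin the radial function is C² in one real variable and extends u
from the half-line, so u and u' have limits at 0. -/
lemma IsRegularSolution.isRegularAtOrigin {n k : ℕ} {p : ℝ} {u : ℝ → ℝ}
    (h : IsRegularSolution n k p u) (hk : 1 < k) (hkn : 2 * k < n) (hp : 1 < p) :
    IsRegularAtOrigin n k p u := by
  have hn : 0 < n := by omega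
  let e : EuclideanSpace ℝ (Fin n) := EuclideanSpace.single ⟨0, hn⟩ 1
  have he : ‖e‖ = 1 := by simp [e]
  have hnorm : ∀ r : ℝ, ‖r • e‖ = |r| := fun r => by rw [norm_smul, he, mul_one, Real.norm_eq_abs]
  have hv : ContDiff ℝ 2 (fun r : ℝ => u ‖r • e‖) :=
    h.contDiff_norm.comp (contDiff_id.smul contDiff_const)
  set v : ℝ → ℝ := fun r : ℝ => u ‖r • e‖ with hvdef
  have huv : ∀ r, 0 ≤ r → u r = v r := fun r hr => by
    simp only [hvdef, hnorm, abs_of_nonneg hr]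
  have hderiv : ∀ r ∈ Ioi (0 : ℝ), deriv u r = deriv v r := fun r hr => by
    refine Filter.EventuallyEq.deriv_eq ?_
    filter_upwards [Ioi_mem_nhds hr] with s hs using huv s (le_of_lt hs)
  have hdv : Continuous (deriv v) := hv.continuous_deriv (by norm_num)
  have hlim : Tendsto (deriv u) (𝓝[>] 0) (𝓝 (deriv v 0)) := by
    refine ((hdv.tendsto 0).mono_left nhdsWithin_le_nhds).congr' ?_
    filter_upwards [self_mem_nhdsWithin] with r hr using (hderiv r hr).symm
  have hid : Tendsto (fun r : ℝ => r) (𝓝[>] 0) (𝓝 0) := nhdsWithin_le_nhds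
  refine ⟨⟨hk, hkn, hp, h.toIsSolution, ?_⟩, ⟨u 0, h.zero_pos, ?_⟩, ⟨_, hlim.neg⟩⟩
  · have := ((hid.pow (n - k)).mul (hlim.abs.pow (k - 1))).mul hlim
    rwa [zero_pow (by omega), zero_mul, zero_mul] at this
  · rw [huv 0 le_rfl]
    refine ((hv.continuous.tendsto 0).mono_left nhdsWithin_le_nhds).congr' ?_
    filter_upwards [self_mem_nhdsWithin] with r hr using (huv r (le_of_lt hr)).symm

/-! ### The Sobolev exponent -/

lemma pSobolev_add_one {n k : ℕ} (h : (0 : ℝ) < n - 2 * k) :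
    pSobolev n k + 1 = n * (k + 1) / (n - 2 * k) := by
  rw [pSobolev, div_add_one h.ne']
  congr 1
  ring

namespace IsRegularAtOrigin

variable {n k : ℕ} {p : ℝ} {u : ℝ → ℝ}

/-- The Pohozaev identity for regular solutions with the Sobolev exponent. -/
lemma pohozaev (h : IsRegularAtOrigin n k p u) (hp : p = pSobolev n k) {r : ℝ} (hr : 0 < r) :
    r ^ n * u r ^ (p + 1) / (p + 1)
      + coeff n k * (k / (k + 1)) * (r * speed u r * outflux n k u r)
      - coeff n k * ((n - 2 * k) / (k + 1)) * (u r * outflux n k u r) = 0 := by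
  have hk : (0 : ℝ) < k := by exact_mod_cast h.k_pos
  have hkn : (0 : ℝ) < n - 2 * k := by
    have : (2 * k : ℝ) < n := by exact_mod_cast h.two_mul_lt
    linarith
  have hn : (0 : ℝ) < n := by linarith
  have hc := h.coeff_pos
  have hp1 := h.one_lt_exponent
  have hn0 : n ≠ 0 := by have := h.two_mul_lt; omega
  set f : ℝ → ℝ := fun r => r ^ n * u r ^ (p + 1) / (p + 1)
      + coeff n k * (k / (k + 1)) * (r * speed u r * outflux n k u r)
      - coeff n k * ((n - 2 * k) / (k + 1)) * (u r * outflux n k u r) with hf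
  have hderiv : ∀ s ∈ Ioi (0 : ℝ), HasDerivAt f 0 s := by
    intro s hs
    have hs : 0 < s := hs
    have hu := h.pos hs
    have hF := h.outflux_pos hs
    have h1 := ((hasDerivAt_pow n s).mul (h.hasDerivAt_rpow (p + 1) hs)).div_const (p + 1)
    have h2 := ((((hasDerivAt_id s).mul (h.hasDerivAt_speed hs)).mul
      (h.hasDerivAt_outflux hs)).const_mul (coeff n k * (k / (k + 1))))
    have h3 := (((h.hasDerivAt hs).mul (h.hasDerivAt_outflux hs)).const_mul
      (coeff n k * ((n - 2 * k) / (k + 1))))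
    refine ((h1.add h2).sub h3).congr_deriv ?_
    obtain ⟨j, hj⟩ : ∃ j, n = j + 1 := ⟨n - 1, by omega⟩
    have e1 : s ^ n = s ^ (n - 1) * s := by rw [hj]; simp [pow_succ]
    rw [add_sub_cancel_right, Real.rpow_add_one hu.ne', e1]
    have hp1e : p + 1 = n * (k + 1) / (n - 2 * k) := hp ▸ pSobolev_add_one hkn
    obtain ⟨m, hm⟩ : ∃ m : ℝ, m = n - 2 * k := ⟨_, rfl⟩
    have hnm : (n : ℝ) = m + 2 * k := by rw [hm]; ring
    rw [hp1e]
    rw [← hm] at hkn ⊢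
    rw [hnm] at hn ⊢
    simp only [id, Pi.mul_apply]
    field_simp
    ring
  obtain ⟨l, hl, hul⟩ := h.exists_tendsto
  obtain ⟨d, hd⟩ := h.exists_tendsto_speed
  have hid : Tendsto (fun r : ℝ => r) (𝓝[>] 0) (𝓝 0) := nhdsWithin_le_nhds
  have hlim : Tendsto f (𝓝[>] 0) (𝓝 0) := by
    have := ((((hid.pow n).mul (hul.rpow_const (p := p + 1) (Or.inl hl.ne'))).div_const
      (p + 1)).add (((hid.mul hd).mul h.tendsto_outflux).const_mul
        (coeff n k * (k / (k + 1))))).sub ((hul.mul h.tendsto_outflux).const_mul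
        (coeff n k * ((n - 2 * k) / (k + 1))))
    simpa [hn0] using this
  have hconst : Tendsto f (𝓝[>] 0) (𝓝 (f r)) := by
    refine tendsto_const_nhds.congr' ?_
    filter_upwards [self_mem_nhdsWithin] with s hs
    exact eq_of_hasDerivAt_zero hderiv hr hs
  exact tendsto_nhds_unique hconst hlim

/-- Regular solutions with the Sobolev exponent decay like `r^{-(n-2k)/k}`. -/
lemma exists_decay_of_eq_pSobolev (h : IsRegularAtOrigin n k p u) (hp : p = pSobolev n k) :
    ∃ C : ℝ, ∀ r, 0 < r → u r ≤ C * r ^ (-(((n : ℝ) - 2 * k) / k)) := by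
  have hk : (0 : ℝ) < k := by exact_mod_cast h.k_pos
  have hkn : (0 : ℝ) < n - 2 * k := by
    have : (2 * k : ℝ) < n := by exact_mod_cast h.two_mul_lt
    linarith
  have hn : (0 : ℝ) < n := by linarith
  have hc := h.coeff_pos
  set m : ℝ := n - 2 * k with hm
  -- W is a first integral: with y = ru'/u up to sign, Pohozaev reads r^n u^p/(cF) = n - k(n/m)y,
  -- where c is `coeff n k` and F the outward flux, and this is what cancels W'.
  set W : ℝ → ℝ := fun r => u r ^ (-(n / m)) * speed u r / r with hW
  have hWd : ∀ r ∈ Ioi (0 : ℝ), HasDerivAt W 0 r := by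
    intro r hr
    have hr : 0 < r := hr
    have hu := h.pos hr
    have hF := h.outflux_pos hr
    have hg := h.speed_pos hr
    refine (((h.hasDerivAt_rpow (-(n / m)) hr).mul (h.hasDerivAt_speed hr)).div
      (hasDerivAt_id r) hr.ne').congr_deriv ?_
    have hX : r ^ n * u r ^ p / (coeff n k * outflux n k u r)
        = n - k * (n / m) * (r * speed u r / u r) := by
      have hpoh := h.pohozaev hp hr
      have hp1e : p + 1 = n * (k + 1) / m := by
        rw [hp, pSobolev_add_one hkn]
      rw [Real.rpow_add_one hu.ne', hp1e] at hpoh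
      field_simp at hpoh ⊢
      linear_combination hpoh
    rw [hX, Real.rpow_sub_one hu.ne']
    simp only [id, Pi.mul_apply]
    have hnm : (n : ℝ) = m + 2 * k := by rw [hm]; ring
    field_simp
    rw [hnm]
    ring
  have hWpos : 0 < W 1 := by
    have := h.pos one_pos
    have := h.speed_pos one_pos
    simp only [hW]
    positivity
  -- Integrating W = const gives u^{-2k/m} = const + W(1)(k/m)r², the explicit bubble. The constant
  -- is nonnegative, as seen by letting r → 0, and dropping it gives the decay.
  set f : ℝ → ℝ := fun r => u r ^ (-(2 * k / m)) - W 1 * (k / m) * r ^ 2 with hf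
  have hfd : ∀ r ∈ Ioi (0 : ℝ), HasDerivAt f 0 r := by
    intro r hr
    have hr : 0 < r := hr
    refine ((h.hasDerivAt_rpow (-(2 * k / m)) hr).sub
      ((hasDerivAt_pow 2 r).const_mul (W 1 * (k / m)))).congr_deriv ?_
    have e1 : -(2 * k / m) - 1 = -((n : ℝ) / m) := by
      field_simp
      rw [hm]
      ring
    rw [e1, eq_of_hasDerivAt_zero hWd one_pos hr]
    simp only [hW]
    field_simp
    simp
  have hfnonneg : ∀ r, 0 < r → 0 ≤ f r := by
    intro r hr
    have hid : Tendsto (fun r : ℝ => r) (𝓝[>] 0) (𝓝 0) := nhdsWithin_le_nhds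
    have hlim : Tendsto (fun s : ℝ => -(W 1 * (k / m) * s ^ 2)) (𝓝[>] 0) (𝓝 0) := by
      simpa using ((hid.pow 2).const_mul (W 1 * (k / m))).neg
    refine le_of_tendsto hlim ?_
    filter_upwards [self_mem_nhdsWithin] with s hs
    rw [eq_of_hasDerivAt_zero hfd hr hs]
    have := h.pos hs
    have : 0 < u s ^ (-(2 * k / m)) := by positivity
    simp only [hf]
    linarith
  refine ⟨(W 1 * (k / m)) ^ (-(m / (2 * k))), fun r hr => ?_⟩
  have hu := h.pos hr
  have h1 : W 1 * (k / m) * r ^ 2 ≤ u r ^ (-(2 * k / m)) := by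
    have := hfnonneg r hr
    simp only [hf] at this
    linarith
  have h2 := Real.rpow_le_rpow_of_nonpos (z := -(m / (2 * k))) (by positivity) h1
    (neg_nonpos.2 (by positivity))
  rw [← Real.rpow_mul hu.le, Real.mul_rpow (by positivity) (by positivity),
    ← Real.rpow_natCast r 2, ← Real.rpow_mul hr.le] at h2
  have e1 : -(2 * k / m) * -(m / (2 * k)) = 1 := by field_simp
  have e2 : ((2 : ℕ) : ℝ) * -(m / (2 * k)) = -(m / k) := by push_cast; field_simp
  rwa [e1, e2, Real.rpow_one] at h2

end IsRegularAtOrigin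

/-! ### The Joseph-Lundgren range -/

lemma exists_first_nonpos {f : ℝ → ℝ} (hf : ContinuousOn f (Ioi 0))
    (h0 : ∀ᶠ r in 𝓝[>] (0 : ℝ), 0 < f r) {T' : ℝ} (hT' : 0 < T') (hfT' : f T' ≤ 0) :
    ∃ T, 0 < T ∧ f T ≤ 0 ∧ ∀ r ∈ Ioo 0 T, 0 < f r := by
  obtain ⟨ε, hε, hpos⟩ := mem_nhdsGT_iff_exists_Ioo_subset.1 h0
  have hε : 0 < ε := hε
  have hK : IsCompact (Icc (ε / 2) T' ∩ f ⁻¹' Iic 0) := by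
    refine isCompact_Icc.of_isClosed_subset ?_ inter_subset_left
    exact (hf.mono fun r hr => (half_pos hε).trans_le hr.1).preimage_isClosed_of_isClosed
      isClosed_Icc isClosed_Iic
  have hεT' : ε ≤ T' := by
    by_contra! hlt
    exact absurd (show 0 < f T' from hpos ⟨hT', hlt⟩) (not_lt.2 hfT')
  obtain ⟨T, hT, hmin⟩ := hK.exists_isLeast ⟨T', ⟨by linarith, le_rfl⟩, hfT'⟩
  refine ⟨T, (half_pos hε).trans_le hT.1.1, hT.2, fun r hr => ?_⟩
  by_contra! hle
  rcases lt_or_ge r ε with hrε | hrε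
  · exact absurd (show 0 < f r from hpos ⟨hr.1, hrε⟩) (not_lt.2 hle)
  · have := hmin ⟨⟨by linarith, hr.2.le.trans hT.1.2⟩, hle⟩
    linarith [hr.2]

/-- The logarithmic slope `-r u'/u`. -/
def slope (u : ℝ → ℝ) (r : ℝ) : ℝ := r * speed u r / u r

/-- The logarithmic derivative of the flux along a solution. -/
def fluxSlope (n k : ℕ) (p : ℝ) (u : ℝ → ℝ) (r : ℝ) : ℝ :=
  r ^ n * u r ^ p / (coeff n k * outflux n k u r)

namespace HasVanishingFlux

variable {n k : ℕ} {p : ℝ} {u : ℝ → ℝ}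

lemma n_pos (h : HasVanishingFlux n k p u) : 0 < n := h.k_pos.trans_le h.k_le

lemma slope_pos (h : HasVanishingFlux n k p u) {r : ℝ} (hr : 0 < r) : 0 < slope u r := by
  have := h.pos hr
  have := h.speed_pos hr
  unfold slope
  positivity

/-- Together with `hasDerivAt_fluxSlope`, an autonomous quadratic system in log r for y = `slope`
and X = `fluxSlope`. -/
lemma hasDerivAt_slope (h : HasVanishingFlux n k p u) {r : ℝ} (hr : 0 < r) :
    HasDerivAt (slope u)
      (slope u r * (1 + (fluxSlope n k p u r - (n - k)) / k + slope u r) / r) r := by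
  have hk : (0 : ℝ) < k := by exact_mod_cast h.k_pos
  have hu := h.pos hr
  refine (((hasDerivAt_id r).mul (h.hasDerivAt_speed hr)).div (h.hasDerivAt hr)
    hu.ne').congr_deriv ?_
  rw [← fluxSlope]
  unfold slope
  simp only [id, Pi.mul_apply]
  field_simp
  ring

lemma hasDerivAt_fluxSlope (h : HasVanishingFlux n k p u) {r : ℝ} (hr : 0 < r) :
    HasDerivAt (fluxSlope n k p u)
      (fluxSlope n k p u r * (n - p * slope u r - fluxSlope n k p u r) / r) r := by
  have hu := h.pos hr
  have hF := h.outflux_pos hr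
  have hc := h.coeff_pos
  refine (((hasDerivAt_pow n r).mul (h.hasDerivAt_rpow p hr)).div
    ((h.hasDerivAt_outflux hr).const_mul (coeff n k)) (by positivity)).congr_deriv ?_
  unfold slope fluxSlope
  obtain ⟨j, hj⟩ : ∃ j, n = j + 1 := ⟨n - 1, by have := h.n_pos; omega⟩
  have e1 : r ^ n = r ^ (n - 1) * r := by rw [hj]; simp [pow_succ]
  rw [Real.rpow_sub_one hu.ne', e1]
  simp only [Pi.mul_apply, e1]
  field_simp
  ring

lemma hasDerivAt_outflux_slope (h : HasVanishingFlux n k p u) {r : ℝ} (hr : 0 < r) :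
    HasDerivAt (outflux n k u) (outflux n k u r * fluxSlope n k p u r / r) r := by
  have hF := h.outflux_pos hr
  have hc := h.coeff_pos
  refine (h.hasDerivAt_outflux hr).congr_deriv ?_
  obtain ⟨j, hj⟩ : ∃ j, n = j + 1 := ⟨n - 1, by have := h.n_pos; omega⟩
  have e1 : r ^ n = r ^ (n - 1) * r := by rw [hj]; simp [pow_succ]
  unfold fluxSlope
  rw [e1]
  field_simp

lemma hasDerivAt_rpow_slope (h : HasVanishingFlux n k p u) (q : ℝ) {r : ℝ} (hr : 0 < r) :
    HasDerivAt (fun s => u s ^ q) (-(q * u r ^ q * slope u r / r)) r := by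
  have hu := h.pos hr
  refine (h.hasDerivAt_rpow q hr).congr_deriv ?_
  unfold slope
  rw [Real.rpow_sub_one hu.ne']
  field_simp

end HasVanishingFlux

namespace IsRegularAtOrigin

variable {n k : ℕ} {p : ℝ} {u : ℝ → ℝ}

lemma tendsto_slope (h : IsRegularAtOrigin n k p u) : Tendsto (slope u) (𝓝[>] 0) (𝓝 0) := by
  obtain ⟨l, hl, hul⟩ := h.exists_tendsto
  obtain ⟨d, hd⟩ := h.exists_tendsto_speed
  have hid : Tendsto (fun r : ℝ => r) (𝓝[>] 0) (𝓝 0) := nhdsWithin_le_nhds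
  have := (hid.mul hd).div hul hl.ne'
  rwa [zero_mul, zero_div] at this

/-- Since u decreases, replacing u by its value at r in the integral of the source over (0,r) bounds
the flux below by r^n u^p/n. -/
lemma fluxSlope_le (h : IsRegularAtOrigin n k p u) {r : ℝ} (hr : 0 < r) :
    fluxSlope n k p u r ≤ n := by
  have hn : (0 : ℝ) < n := by exact_mod_cast h.n_pos
  have hn0 : n ≠ 0 := h.n_pos.ne'
  have hp := h.one_lt_exponent
  have hmono : MonotoneOn (fun s => coeff n k * outflux n k u s - s ^ n * u s ^ p / n) (Ioi 0) := by
    refine monotoneOn_of_hasDerivAt_nonneg (convex_Ioi 0)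
      (f' := fun s => s ^ n * (p * u s ^ (p - 1) * speed u s) / n) (fun s hs => ?_) fun s hs => ?_
    · have hc := h.coeff_pos
      refine (((h.hasDerivAt_outflux hs).const_mul (coeff n k)).sub
        (((hasDerivAt_pow n s).mul (h.hasDerivAt_rpow p hs)).div_const n)).congr_deriv ?_
      field_simp
      ring
    · have hs : 0 < s := hs
      have := h.pos hs
      have := h.speed_pos hs
      positivity
  obtain ⟨l, hl, hul⟩ := h.exists_tendsto
  have hid : Tendsto (fun r : ℝ => r) (𝓝[>] 0) (𝓝 0) := nhdsWithin_le_nhds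
  have hlim : Tendsto (fun s => coeff n k * outflux n k u s - s ^ n * u s ^ p / n)
      (𝓝[>] 0) (𝓝 0) := by
    have := (h.tendsto_outflux.const_mul (coeff n k)).sub
      (((hid.pow n).mul (hul.rpow_const (p := p) (Or.inl hl.ne'))).div_const (n : ℝ))
    simpa [hn0] using this
  have h1 := le_of_monotoneOn_of_tendsto hmono hlim hr
  have hF := h.outflux_pos hr
  have hc := h.coeff_pos
  unfold fluxSlope
  rw [div_le_iff₀ (by positivity)]
  rw [sub_nonneg, div_le_iff₀ hn] at h1
  linarith

/-- In the Joseph-Lundgren range the slope of a regular solution stays below that of the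
explicit singular solution. -/
lemma slope_lt (h : IsRegularAtOrigin n k p u) {α x₀ : ℝ} (hα : 0 < α)
    (hαp : α * (p - k) = 2 * k) (hx₀ : x₀ = n - p * α) (hx₀α : α < x₀)
    (hJL : 8 * x₀ ≤ (x₀ - α) ^ 2) {r : ℝ} (hr : 0 < r) : slope u r < α := by
  have hk : (0 : ℝ) < k := by exact_mod_cast h.k_pos
  by_contra! hcon
  obtain ⟨T, hT, hfT, hpos⟩ := exists_first_nonpos (f := fun r => α - slope u r)
    (fun s hs => ((h.hasDerivAt_slope hs).const_sub α).continuousAt.continuousWithinAt)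
    (by
      filter_upwards [h.tendsto_slope.eventually_lt_const hα] with s hs
      linarith) hr (sub_nonpos.2 hcon)
  -- the slope of the barrier line
  obtain ⟨s, hs⟩ : ∃ s : ℝ, s = k * (α + x₀) / (2 * α) := ⟨_, rfl⟩
  have hx₀8 : 8 ≤ x₀ := by nlinarith
  have hx₀4 : α + 4 < x₀ := by nlinarith
  have hαp' : p * α = k * (α + 2) := by linarith
  have hsα : s * α = k * (α + x₀) / 2 := by rw [hs]; field_simp
  have hsp : p < s := by
    refine lt_of_mul_lt_mul_right (a := α) ?_ hα.le
    rw [hsα, hαp']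
    nlinarith
  have hpk : (k : ℝ) < p := by
    refine lt_of_mul_lt_mul_right (a := α) ?_ hα.le
    rw [hαp']
    nlinarith
  -- The line X = x₀ + s(α - y) passes through the equilibrium (α, x₀). The condition is quadratic
  -- in s, and the chosen s is its vertex; a solution exists iff the discriminant (x₀-α)² - 8x₀ of
  -- the linearization is nonnegative.
  have hbar : s * α * (s - k) / k ≤ x₀ * (s - p) := by
    have e1 : s * α * (s - k) / k - x₀ * (s - p) = ((8 * x₀ - (x₀ - α) ^ 2) * k) / (4 * α) := by
      have e2 : p = k * (α + 2) / α := by rw [← hαp']; field_simp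
      rw [hs, e2]
      field_simp
      ring
    have e3 : ((8 * x₀ - (x₀ - α) ^ 2) * k) / (4 * α) ≤ 0 :=
      div_nonpos_of_nonpos_of_nonneg (mul_nonpos_of_nonpos_of_nonneg (by linarith) hk.le)
        (by positivity)
    linarith
  set ψ : ℝ → ℝ := fun r => fluxSlope n k p u r - x₀ - s * (α - slope u r) with hψ
  -- Integrating factor: it removes the terms proportional to ψ from (ψG)', leaving a multiple of α
  -- - y whose sign is given by `hbar`.
  set G : ℝ → ℝ := fun r => u r ^ (s / k + (s - p)) * outflux n k u r * r ^ ((s - p) * α) with hG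
  have hGpos : ∀ r, 0 < r → 0 < G r := fun r hr => by
    have := h.pos hr
    have := h.outflux_pos hr
    simp only [hG]
    positivity
  have hn : (n : ℝ) = x₀ + k * (α + 2) := by linarith
  have hψd : ∀ r ∈ Ioo 0 T, HasDerivAt (fun r => ψ r * G r) (G r / r * ((α - slope u r) *
      (s * slope u r * (s - k) / k - (x₀ + s * (α - slope u r)) * (s - p)))) r := by
    intro r hr
    have hr : 0 < r := hr.1
    have hu := h.pos hr
    have h1 := ((h.hasDerivAt_fluxSlope hr).sub_const x₀).sub
      (((h.hasDerivAt_slope hr).const_sub α).const_mul s)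
    have h2 := ((h.hasDerivAt_rpow_slope (s / k + (s - p)) hr).mul (h.hasDerivAt_outflux_slope hr)).mul
      (Real.hasDerivAt_rpow_const (p := (s - p) * α) (Or.inl hr.ne'))
    refine (h1.mul h2).congr_deriv ?_
    simp only [Pi.mul_apply, Pi.sub_apply, hG]
    rw [Real.rpow_sub_one hr.ne']
    generalize fluxSlope n k p u r = X
    generalize slope u r = y
    generalize u r ^ (s / k + (s - p)) = U
    generalize r ^ ((s - p) * α) = ρ
    have e2 : (p : ℝ) = k * (α + 2) / α := by rw [← hαp']; field_simp
    rw [hn, e2]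
    field_simp
    ring
  have hψanti : AntitoneOn (fun r => ψ r * G r) (Ioo 0 T) := by
    refine antitoneOn_of_hasDerivAt_nonpos (convex_Ioo 0 T) hψd fun r hr => ?_
    have he : 0 < α - slope u r := hpos r hr
    have hy := h.slope_pos hr.1
    have hg := hGpos r hr.1
    have hr0 := hr.1
    refine mul_nonpos_of_nonneg_of_nonpos (by positivity)
      (mul_nonpos_of_nonneg_of_nonpos he.le ?_)
    have h1 : s * slope u r * (s - k) / k ≤ s * α * (s - k) / k := by
      have : 0 ≤ s - k := by linarith
      have : 0 ≤ s := by linarith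
      gcongr
      linarith
    have h2 : x₀ * (s - p) ≤ (x₀ + s * (α - slope u r)) * (s - p) := by
      have : 0 ≤ s - p := by linarith
      have : 0 ≤ s := by linarith
      have : 0 ≤ s * (α - slope u r) := by positivity
      gcongr
      linarith
    linarith
  -- Near 0 the orbit lies below the line, since X ≤ n and y → 0 give ψ ≤ (p-s)α + sy < 0.
  -- Monotonicity of ψG propagates this up to T.
  have hψneg : ∀ r ∈ Ioo 0 T, ψ r < 0 := by
    intro r hr
    have hev : ∀ᶠ t in 𝓝[>] (0 : ℝ), slope u t < (s - p) * α / s :=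
      h.tendsto_slope.eventually_lt_const (by
        have : 0 < s - p := by linarith
        have : 0 < s := by linarith
        positivity)
    obtain ⟨t, ht1, ht2⟩ := (hev.and (Ioo_mem_nhdsGT hr.1)).exists
    have htT : t ∈ Ioo 0 T := ⟨ht2.1, ht2.2.trans hr.2⟩
    have hψt : ψ t < 0 := by
      have := h.fluxSlope_le ht2.1
      rw [lt_div_iff₀ (by linarith)] at ht1
      simp only [hψ]
      nlinarith
    have h1 := hψanti htT hr ht2.2.le
    have h2 := mul_neg_of_neg_of_pos hψt (hGpos t ht2.1)
    exact neg_of_mul_neg_left (h1.trans_lt h2) (hGpos r hr.1).le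
  -- The power of u makes E' a negative multiple of ψ. Below the line E is nondecreasing, so the
  -- positive quantity α - y cannot reach 0 at T.
  set E : ℝ → ℝ := fun r => (α - slope u r) * u r ^ (1 - s / k) with hE
  have hEd : ∀ r, 0 < r → HasDerivAt E
      (-(u r ^ (1 - s / k) * slope u r * ψ r / (k * r))) r := by
    intro r hr
    refine (((h.hasDerivAt_slope hr).const_sub α).mul
      (h.hasDerivAt_rpow_slope (1 - s / k) hr)).congr_deriv ?_
    simp only [hψ]
    rw [hn]
    field_simp
    ring
  have hEmono : MonotoneOn E (Ioo 0 T) := by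
    refine monotoneOn_of_hasDerivAt_nonneg (convex_Ioo 0 T) (fun r hr => hEd r hr.1) fun r hr => ?_
    have hu := h.pos hr.1
    have hy := h.slope_pos hr.1
    have hψr := hψneg r hr
    have hr0 := hr.1
    rw [← neg_div, ← mul_neg]
    have : 0 < -ψ r := by linarith
    positivity
  have hET : E (T / 2) ≤ E T := by
    have hlim : Tendsto E (𝓝[<] T) (𝓝 (E T)) :=
      (hEd T hT).continuousAt.tendsto.mono_left nhdsWithin_le_nhds
    refine ge_of_tendsto hlim ?_
    filter_upwards [Ioo_mem_nhdsLT (half_lt_self hT)] with t ht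
    exact hEmono ⟨half_pos hT, half_lt_self hT⟩ ⟨(half_pos hT).trans ht.1, ht.2⟩ ht.1.le
  have h1 : 0 < E (T / 2) := by
    have := hpos (T / 2) ⟨half_pos hT, half_lt_self hT⟩
    have := h.pos (half_pos hT)
    simp only [hE]
    positivity
  have h2 : E T ≤ 0 := by
    have := h.pos hT
    exact mul_nonpos_of_nonpos_of_nonneg hfT (by positivity)
  linarith

/-- In the Joseph-Lundgren range regular solutions are stable on `(R,∞)` for every `R > 0`: the
scaling derivative `α u + r u'` is a positive solution of the linearized equation. -/
lemma isStableOn_of_josephLundgren (h : IsRegularAtOrigin n k p u) {α x₀ : ℝ} (hα : 0 < α)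
    (hαp : α * (p - k) = 2 * k) (hx₀ : x₀ = n - p * α) (hx₀α : α < x₀)
    (hJL : 8 * x₀ ≤ (x₀ - α) ^ 2) {R : ℝ} (hR : 0 < R) : IsStableOn n k p R u := by
  have hk : (0 : ℝ) < k := by exact_mod_cast h.k_pos
  have hc := h.coeff_pos
  have hφpos : ∀ r, 0 < r → 0 < α * u r - r * speed u r := fun r hr => by
    have := h.slope_lt hα hαp hx₀ hx₀α hJL hr
    unfold slope at this
    rw [div_lt_iff₀ (h.pos hr)] at this
    linarith
  -- N is wφ' for the scaling derivative φ, written without u''; N' = -Vφ is then the linearized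
  -- equation.
  set N : ℝ → ℝ := fun r => coeff n k * x₀ * outflux n k u r - r ^ n * u r ^ p with hN
  set φ : ℝ → ℝ := fun r => α * u r - r * speed u r with hφ
  set V : ℝ → ℝ := fun r => p * (r ^ (n - 1) * u r ^ (p - 1)) with hV
  have hNd : ∀ r, 0 < r → HasDerivAt N (-(V r * φ r)) r := by
    intro r hr
    have hu := h.pos hr
    refine (((h.hasDerivAt_outflux hr).const_mul (coeff n k * x₀)).sub
      ((hasDerivAt_pow n r).mul (h.hasDerivAt_rpow p hr))).congr_deriv ?_
    simp only [hV, hφ]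
    obtain ⟨j, hj⟩ : ∃ j, n = j + 1 := ⟨n - 1, by have := h.n_pos; omega⟩
    have e1 : r ^ n = r ^ (n - 1) * r := by rw [hj]; simp [pow_succ]
    rw [Real.rpow_sub_one hu.ne', e1, hx₀]
    field_simp
    ring
  have hφd : ∀ r, 0 < r → HasDerivAt φ
      (N r / (binom n k * (r ^ (n - k) * speed u r ^ (k - 1)))) r := by
    intro r hr
    have hg := h.speed_pos hr
    have hF := h.outflux_pos hr
    refine (((h.hasDerivAt hr).const_mul α).sub
      ((hasDerivAt_id r).mul (h.hasDerivAt_speed hr))).congr_deriv ?_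
    have e1 : r ^ (n - k) * speed u r ^ (k - 1) = outflux n k u r / speed u r := by
      obtain ⟨j, hj⟩ : ∃ j, k = j + 1 := ⟨k - 1, by have := h.k_pos; omega⟩
      have e2 : speed u r ^ k = speed u r ^ (k - 1) * speed u r := by rw [hj]; simp [pow_succ]
      rw [h.outflux_eq hr, e2]
      field_simp
    have hn : (n : ℝ) = x₀ + k * (α + 2) := by linarith
    rw [e1, ← mul_coeff h.k_pos]
    simp only [hN, id]
    rw [hn]
    field_simp
    ring
  -- θ = wφ'/φ with φ positive turns the linear equation into the Riccati relation with equality.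
  refine h.isStableOn_of_riccati hR (θ := fun r => N r / φ r)
    (θ' := fun r => (-(V r * φ r) * φ r
      - N r * (N r / (binom n k * (r ^ (n - k) * speed u r ^ (k - 1))))) / φ r ^ 2)
    (fun r hr => ?_) fun r hr => ?_
  · have hr : 0 < r := hR.trans hr
    exact (hNd r hr).div (hφd r hr) (hφpos r hr).ne'
  · have hr : 0 < r := hR.trans hr
    have h1 : 0 < φ r := hφpos r hr
    have hg := h.speed_pos hr
    have hb := h.binom_pos
    have hw : 0 < binom n k * (r ^ (n - k) * speed u r ^ (k - 1)) := by positivity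
    change _ + _ + V r ≤ 0
    refine le_of_eq ?_
    generalize binom n k * (r ^ (n - k) * speed u r ^ (k - 1)) = w at hw ⊢
    field_simp
    ring

end IsRegularAtOrigin

/-- The exponents `p ≥ max(p^*, p_jl)` in terms of the decay rate `α = 2k/(p-k)`. -/
lemma josephLundgren_of_le {n k : ℕ} {p : ℝ} (hk1 : 1 < k) (hkn : 2 * k < n)
    (hp : max ((pStar n k : ℝ) : EReal) (pJL n k) ≤ (p : EReal)) :
    ∃ α x₀ : ℝ, 0 < α ∧ α * (p - k) = 2 * k ∧ x₀ = n - p * α ∧ α < x₀ ∧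
      8 * x₀ ≤ (x₀ - α) ^ 2 := by
  have hk' : (0 : ℝ) < k := by exact_mod_cast zero_lt_one.trans hk1
  have hk1' : (1 : ℝ) < k := by exact_mod_cast hk1
  have hm : (0 : ℝ) < n - 2 * k := by
    have : (2 * k : ℝ) < n := by exact_mod_cast hkn
    linarith
  obtain ⟨h1, h2⟩ := max_le_iff.1 hp
  rw [EReal.coe_le_coe_iff, pStar, mul_div_assoc', div_le_iff₀ hm] at h1
  unfold pJL at h2
  split_ifs at h2 with hn8
  · exact absurd (top_le_iff.1 h2) (EReal.coe_ne_top p)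
  have hn8' : (0 : ℝ) < n - 2 * k - 8 := by
    have : (2 * k + 8 : ℝ) < n := by exact_mod_cast not_le.1 hn8
    linarith
  rw [EReal.coe_le_coe_iff, div_le_iff₀ (mul_pos hm hn8')] at h2
  set S := Real.sqrt (2 * ((k : ℝ) + 1) * n - 4 * k) with hS
  have hSnonneg : 0 ≤ S := Real.sqrt_nonneg _
  have hSsq : S ^ 2 = 2 * ((k : ℝ) + 1) * n - 4 * k := Real.sq_sqrt (by nlinarith)
  obtain ⟨m, hmdef⟩ : ∃ m : ℝ, m = n - 2 * k := ⟨_, rfl⟩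
  have hnm : (n : ℝ) = m + 2 * k := by linarith
  rw [hnm] at h1 h2 hSsq hm hn8'
  have hpk : 0 < p - k := by nlinarith
  obtain ⟨α, hαdef⟩ : ∃ α : ℝ, α = 2 * k / (p - k) := ⟨_, rfl⟩
  have hα : 0 < α := by rw [hαdef]; positivity
  have hαp : α * (p - k) = 2 * k := by rw [hαdef]; field_simp
  have hm' : 0 < m := by linarith
  -- This is p ≥ p^* in terms of α. As k > 1, it gives (k+1)α < m, that is α < x₀.
  have hstar : 2 * k * α ≤ m := by
    rw [hαdef, mul_div_assoc', div_le_iff₀ hpk]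
    nlinarith
  have hE : α * ((k + 1) * m - 4 * k + 2 * S) ≤ m * (m - 8) := by
    have e1 : 2 * k * ((k + 1) * m - 4 * k + 2 * S) ≤ m * (m - 8) * (p - k) := by linarith
    rw [hαdef, div_mul_eq_mul_div, div_le_iff₀ hpk]
    exact e1
  have hx : (n : ℝ) - p * α = m - k * α := by
    rw [hnm]
    linarith
  refine ⟨α, n - p * α, hα, hαp, rfl, ?_, ?_⟩
  · rw [hx]
    nlinarith
  · rw [hx]
    have hD : 0 < m * (m - 8) := mul_pos hm' (by linarith)
    have hsq : (2 * S * α) ^ 2 ≤ (m * (m - 8) - α * ((k + 1) * m - 4 * k)) ^ 2 := by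
      have : 0 ≤ 2 * S * α := by positivity
      gcongr
      linarith
    -- Squaring `hE` removes the root: the difference of the two squares in `hsq` factors as m(m-8)
    -- times the discriminant.
    have hprod : 0 ≤ m * (m - 8) * ((m - k * α - α) ^ 2 - 8 * (m - k * α)) := by
      have e1 : (2 * S * α) ^ 2 = 4 * (2 * (k + 1) * (m + 2 * k) - 4 * k) * α ^ 2 := by
        rw [← hSsq]; ring
      rw [e1] at hsq
      linarith
    linarith [nonneg_of_mul_nonneg_right hprod hD]

/-! ### Fast decaying singular solutions -/

lemma singularConst_pos {n k : ℕ} {p : ℝ} (hk : 0 < k) (hkn : 2 * k < n)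
    (hp : pSerrin n k < p) : 0 < singularConst n k p ∧ (k : ℝ) < p := by
  have hk' : (0 : ℝ) < k := by exact_mod_cast hk
  have hkn' : (0 : ℝ) < n - 2 * k := by
    have : (2 * k : ℝ) < n := by exact_mod_cast hkn
    linarith
  unfold pSerrin at hp
  rw [div_lt_iff₀ hkn'] at hp
  have hpk : (k : ℝ) < p := by nlinarith
  refine ⟨?_, hpk⟩
  have hpk' : 0 < p - k := by linarith
  have h1 : 0 < (n : ℝ) - 2 * p * k / (p - k) := by
    rw [sub_pos, div_lt_iff₀ hpk']
    nlinarith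
  have h2 : 0 < 1 / (k : ℝ) * binom n k := coeff_pos hk (by omega)
  unfold singularConst
  positivity

/-- The outward flux is monotone, so it has a limit L at 0 once it is bounded below. Blow-up of U at
0 excludes nonpositive values, and L > 0 would force a singularity of order r^{-(n-2k)/k}, stronger
than that of u_s when p exceeds the Serrin exponent. -/
lemma IsFastDecaySingularSolution.hasVanishingFlux {n k : ℕ} {p : ℝ} {U : ℝ → ℝ}
    (h : IsFastDecaySingularSolution n k p U) (hk : 1 < k) (hkn : 2 * k < n) (hp1 : 1 < p)
    (hp : pSerrin n k < p) : HasVanishingFlux n k p U := by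
  have hk0 : 0 < k := by omega
  have hkn0 : k ≤ n := by omega
  have hk' : (0 : ℝ) < k := by exact_mod_cast hk0
  have hkn' : (0 : ℝ) < n - 2 * k := by
    have : (2 * k : ℝ) < n := by exact_mod_cast hkn
    linarith
  obtain ⟨hA, hpk⟩ := singularConst_pos hk0 hkn hp
  set A := singularConst n k p with hAdef
  set α : ℝ := 2 * k / (p - k) with hα
  have hpk' : 0 < p - k := by linarith
  have hαpos : 0 < α := by positivity
  set Y : ℝ := (n - 2 * k) / k with hY
  have hYpos : 0 < Y := by positivity
  have hαY : α < Y := by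
    rw [hα, hY, div_lt_div_iff₀ hpk' hk']
    unfold pSerrin at hp
    rw [div_lt_iff₀ hkn'] at hp
    nlinarith
  have hbounds : ∀ᶠ r in 𝓝[>] (0 : ℝ), A / 2 * r ^ (-α) < U r ∧ U r < 2 * A * r ^ (-α) := by
    filter_upwards [h.tendsto_zero.eventually_const_lt (show (1 / 2 : ℝ) < 1 by norm_num),
      h.tendsto_zero.eventually_lt_const (show (1 : ℝ) < 2 by norm_num), self_mem_nhdsWithin]
      with r h1 h2 hr
    have hr : 0 < r := hr
    have hus : 0 < uSing n k p r := by
      unfold uSing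
      positivity
    rw [lt_div_iff₀ hus] at h1
    rw [div_lt_iff₀ hus] at h2
    have e : uSing n k p r = A * r ^ (-α) := rfl
    rw [e] at h1 h2
    constructor <;> linarith
  have hid : Tendsto (fun r : ℝ => r) (𝓝[>] 0) (𝓝 0) := nhdsWithin_le_nhds
  -- the flux is negative
  have hneg : ∀ r, 0 < r → 0 < outflux n k U r := by
    by_contra! hcon
    obtain ⟨r₁, hr₁, hF⟩ := hcon
    have hmono : MonotoneOn U (Ioc 0 r₁) := by
      refine monotoneOn_of_hasDerivAt_nonneg (convex_Ioc 0 r₁)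
        (fun r hr => h.toIsSolution.hasDerivAt hr.1) fun r hr => ?_
      rw [← flux_nonneg_iff (n := n) (k := k) hr.1]
      have := (h.toIsSolution.monotoneOn_outflux hk0 hkn0 hr.1 hr₁ hr.2).trans hF
      unfold outflux at this
      linarith
    have htop : Tendsto (fun r : ℝ => A / 2 * r ^ (-α)) (𝓝[>] 0) atTop :=
      (tendsto_rpow_neg_nhdsGT_zero (by linarith)).const_mul_atTop (by positivity)
    obtain ⟨r, hr1, hr2, hr3⟩ := (hbounds.and ((htop.eventually_gt_atTop (U r₁)).and
      (Ioo_mem_nhdsGT hr₁))).exists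
    have := hmono ⟨hr3.1, hr3.2.le⟩ ⟨hr₁, le_rfl⟩ hr3.2.le
    linarith [hr1.1]
  have hbdd : BddBelow (outflux n k U '' Ioi 0) := ⟨0, by
    rintro _ ⟨r, hr, rfl⟩
    exact (hneg r hr).le⟩
  have hlim := (h.toIsSolution.monotoneOn_outflux hk0 hkn0).tendsto_nhdsGT hbdd
  set L := sInf (outflux n k U '' Ioi 0) with hL
  have hLnonneg : 0 ≤ L := le_csInf (nonempty_Ioi.image _) (by
    rintro _ ⟨r, hr, rfl⟩
    exact (hneg r hr).le)
  have hLle : ∀ r, 0 < r → L ≤ outflux n k U r := fun r hr => csInf_le hbdd ⟨r, hr, rfl⟩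
  have hL0 : L = 0 := by
    by_contra hne
    have hLpos : 0 < L := lt_of_le_of_ne hLnonneg (Ne.symm hne)
    set B := L ^ (1 / (k : ℝ)) with hB
    have hBpos : 0 < B := by positivity
    have hspeed : ∀ r, 0 < r → B * r ^ (-Y - 1) ≤ -deriv U r := by
      intro r hr
      have hd : deriv U r < 0 := by
        have := (flux_nonneg_iff (n := n) (k := k) (u := U) hr).not.1 (by
          have := hneg r hr
          unfold outflux at this
          linarith)
        linarith
      have hF : outflux n k U r = r ^ (n - k) * (-deriv U r) ^ k := by
        obtain ⟨j, rfl⟩ : ∃ j, k = j + 1 := ⟨k - 1, by omega⟩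
        unfold outflux flux
        rw [abs_of_neg hd]
        simp only [Nat.add_sub_cancel]
        ring
      have h1 := hLle r hr
      rw [hF] at h1
      refine le_of_pow_le_pow_left₀ hk0.ne' (by linarith) ?_
      have e1 : B ^ k = L := by rw [hB, one_div, Real.rpow_inv_natCast_pow hLpos.le hk0.ne']
      have e2 : (r ^ (-Y - 1)) ^ k = (r ^ (n - k))⁻¹ := by
        rw [← Real.rpow_natCast, ← Real.rpow_mul hr.le, ← Real.rpow_natCast, ← Real.rpow_neg hr.le,
          Nat.cast_sub hkn0, hY]
        congr 1
        field_simp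
        ring
      rw [mul_pow, e1, e2, ← div_eq_mul_inv, div_le_iff₀ (by positivity)]
      linarith
    -- Integrating -U' ≥ B r^{-Y-1} from r to 1 gives U ≥ (B/Y)(r^{-Y} - 1). Against U < 2A r^{-α}
    -- with α < Y, multiplying by r^Y and letting r → 0 yields B/Y ≤ 0.
    have hanti : AntitoneOn (fun r => U r - B / Y * r ^ (-Y)) (Ioi 0) := by
      refine antitoneOn_of_hasDerivAt_nonpos (convex_Ioi 0)
        (f' := fun r => deriv U r - B / Y * (-Y * r ^ (-Y - 1))) (fun r hr => ?_) fun r hr => ?_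
      · exact (h.toIsSolution.hasDerivAt hr).sub
          ((Real.hasDerivAt_rpow_const (Or.inl (ne_of_gt hr))).const_mul _)
      · have := hspeed r hr
        have e : B / Y * (-Y * r ^ (-Y - 1)) = -(B * r ^ (-Y - 1)) := by field_simp
        simp only [e]
        linarith
    have hle : ∀ᶠ r in 𝓝[>] (0 : ℝ),
        B / Y ≤ 2 * A * r ^ (Y - α) + (B / Y) * r ^ Y := by
      filter_upwards [hbounds, Ioo_mem_nhdsGT one_pos] with r h1 h2
      have hr : 0 < r := h2.1
      have h3 := hanti hr (mem_Ioi.2 one_pos) h2.2.le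
      simp only [Real.one_rpow] at h3
      have hU1 := h.pos 1 one_pos
      have h4 : B / Y * r ^ (-Y) ≤ 2 * A * r ^ (-α) + B / Y := by linarith [h1.2]
      have h5 := mul_le_mul_of_nonneg_right h4 (show 0 ≤ r ^ Y by positivity)
      have e1 : r ^ (-Y) * r ^ Y = 1 := by rw [← Real.rpow_add hr]; simp
      have e2 : r ^ (-α) * r ^ Y = r ^ (Y - α) := by rw [← Real.rpow_add hr]; congr 1; ring
      calc B / Y = B / Y * r ^ (-Y) * r ^ Y := by rw [mul_assoc, e1, mul_one]
        _ ≤ _ := h5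
        _ = _ := by rw [add_mul, mul_assoc (2 * A), e2]
    have hz : Tendsto (fun r : ℝ => 2 * A * r ^ (Y - α) + (B / Y) * r ^ Y) (𝓝[>] 0) (𝓝 0) := by
      have h1 := (hid.rpow_const (p := Y - α) (Or.inr (by linarith))).const_mul (2 * A)
      have h2 := (hid.rpow_const (p := Y) (Or.inr hYpos.le)).const_mul (B / Y)
      have := h1.add h2
      rwa [Real.zero_rpow (by linarith), Real.zero_rpow hYpos.ne', mul_zero, mul_zero,
        add_zero] at this
    have := ge_of_tendsto hz hle
    have : 0 < B / Y := by positivity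
    linarith
  refine ⟨hk, hkn, hp1, h.toIsSolution, ?_⟩
  rw [hL0] at hlim
  have := hlim.neg
  simp only [outflux, neg_neg, neg_zero] at this
  exact this

lemma IsFastDecaySingularSolution.exists_isStableOn {n k : ℕ} {p : ℝ} {U : ℝ → ℝ}
    (h : IsFastDecaySingularSolution n k p U) (hk : 1 < k) (hkn : 2 * k < n) (hp1 : 1 < p)
    (hp : pSerrin n k < p) : ∃ R : ℝ, 0 < R ∧ IsStableOn n k p R U := by
  obtain ⟨l, hl, hlim⟩ := h.tendsto_atTop
  obtain ⟨R₀, hR₀⟩ := eventually_atTop.1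
    ((hlim.eventually_lt_const (lt_add_one l)).and (eventually_gt_atTop 0))
  refine (h.hasVanishingFlux hk hkn hp1 hp).exists_isStableOn_of_fast_decay hp (C := l + 1)
    (R₀ := R₀) fun r hr => ?_
  obtain ⟨h1, hr0⟩ := hR₀ r hr.le
  rw [Real.rpow_neg hr0.le, ← div_eq_mul_inv, le_div_iff₀ (by positivity)]
  exact h1.le

/-- Stability outside a ball of regular solutions, in the Sobolev case and in the Joseph-Lundgren
range. -/
lemma IsRegularSolution.exists_isStableOn {n k : ℕ} {p : ℝ} {u : ℝ → ℝ}
    (h : IsRegularSolution n k p u) (hk : 1 < k) (hkn : 2 * k < n) (hp1 : 1 < p)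
    (hp : p = pSobolev n k ∨ max ((pStar n k : ℝ) : EReal) (pJL n k) ≤ (p : EReal)) :
    ∃ R : ℝ, 0 < R ∧ IsStableOn n k p R u := by
  have hreg := h.isRegularAtOrigin hk hkn hp1
  rcases hp with hp | hp
  · obtain ⟨C, hC⟩ := hreg.exists_decay_of_eq_pSobolev hp
    refine hreg.exists_isStableOn_of_fast_decay ?_ (R₀ := 0) hC
    have hk' : (0 : ℝ) < k := by exact_mod_cast hreg.k_pos
    have hm : (0 : ℝ) < n - 2 * k := by
      have : (2 * k : ℝ) < n := by exact_mod_cast hkn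
      linarith
    rw [hp, pSerrin, pSobolev]
    gcongr
    linarith
  · obtain ⟨α, x₀, hα, hαp, hx₀, hx₀α, hJL⟩ := josephLundgren_of_le hk hkn hp
    exact ⟨1, one_pos, hreg.isStableOn_of_josephLundgren hα hαp hx₀ hx₀α hJL one_pos⟩

end KHessian

end

theorem theorem1p5 (n k : ℕ) (p : ℝ) (hn : 3 ≤ n) (hk : 1 < k) (hkn : 2 * k < n) (hp : 1 < p) :
    ((p = KHessian.pSobolev n k ∨
        max ((KHessian.pStar n k : ℝ) : EReal) (KHessian.pJL n k) ≤ (p : EReal)) →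
      ∀ u : ℝ → ℝ, KHessian.IsRegularSolution n k p u →
        ∃ R : ℝ, 0 < R ∧ KHessian.IsStableOn n k p R u) ∧
    (KHessian.pSerrin n k < p → p < KHessian.pSobolev n k →
      ∀ U : ℝ → ℝ, KHessian.IsFastDecaySingularSolution n k p U →
        ∃ R : ℝ, 0 < R ∧ KHessian.IsStableOn n k p R U) := by
  exact ⟨fun h u hu => hu.exists_isStableOn hk hkn hp h,
    fun h _ U hU => hU.exists_isStableOn hk hkn hp h⟩
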